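/- Let $k\ge 1$ and $d_1,\dots,d_k\ge 1$. The $d_1\times\dots\times d_k$ grid graph has as vertices the integer points $x$ with $0\le x_i<d_i$; two of them are adjacent if they differ by $1$ in exactly one coordinate and agree in the others. Its diagonals are $V_i=\{x:\sum_j x_j=i\}$; a vertex is called odd or even according to the parity of $\sum_j x_j$. The order $r^*$ puts $x$ before $y$ if $\sum x_j<\sum y_j$, or if $\sum x_j=\sum y_j$ and $x$ is lexicographically larger than $y$. The spinless $M\times N$ Hubbard model has one occupancy state for each vertex of the $M\times N$ grid and the Hamiltonian $U\sum_p n_p-t\sum_{(p,q)\in E}(a_p^\dagger a_q+a_q^\dagger a_p)$; the model with spin has two states $(\sigma,m,n)$, $\sigma\in\{0,1\}$, for each site $(m,n)$ and the Hamiltonian $U\sum_p n_{p,+}n_{p,-}-t\sum_{(p,q)\in E,\sigma}(a_{p,\sigma}^\dagger a_{q,\sigma}+a_{q,\sigma}^\dagger a_{p,\sigma})$ (with $U,t\neq0$). The interaction graph $G$ joins two distinct states that occur in a common summand; it is the $M\times N$ grid in the spinless case and the $2\times M\times N$ grid in the spin case. A swap network for a finite graph $G$ consists of an initial linear order of the vertices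 and a sequence of swap layers and interaction layers. A swap layer exchanges some pairwise disjoint pairs of vertices in consecutive positions of the current order. An interaction layer is a set of pairwise disjoint edges of $G$ whose ends are in consecutive positions of the current order. Every edge of $G$ belongs to exactly one interaction layer. The swap depth and the interaction depth are the numbers of swap layers and of interaction layers; $d_{\rm swap}(G)$ is the minimum swap depth over all swap networks for $G$. The degree of $G$ is a lower bound for the interaction depth. A swap network for the $d_1\times\dots\times d_k$ grid ($k\ge2$) follows the diagonal-interleaving scheme if the following holds. 1. In the initial order the odd vertices are ordered among themselves by $r^*$, so are the even vertices, and each odd vertex $v$ is adjacent to those of $v-e_{k-1}$, $v-e_k$ that are vertices; among all orders with these properties, every odd vertex has the rightmost possible position. 2. In each swap layer, odd vertices never move down and even vertices never move up in the order (so odd vertices are shifted upward past even ones). 3. There are exactly $2k$ interaction layers. The $l$-th of them consists of the interactions of each odd vertex $v$ with the $l$-th entry of the list $v-e_k,v-e_{k-1},\dots,v-e_1,v+e_1,\dots,v+e_{k-1},v+e_k$, whenever that entry is a vertex. **Theorem.** Let $1\le M\le N$. (a) For the spinless $M\times N$ Hubbard model, with interaction graph $G$, there is a swap network following the diagonal-interleaving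 scheme with swap depth $M-1$ and interaction depth $4$. Moreover $d_{\rm swap}(G)=M-1$. If $M\ge3$, then $G$ has degree $4$ and the minimum interaction depth over all swap networks for $G$ is $4$. So this network is then optimal for both depths at the same time. (b) Let $M\ge2$. For the $M\times N$ Hubbard model with spin, with interaction graph $G$, there is a swap network following the diagonal-interleaving scheme with swap depth $2M-1$ and interaction depth $6$, all six interaction layers being nonempty. Moreover $d_{\rm swap}(G)=2M-1$. If $M\ge3$, then $G$ has degree $5$, so every swap network for $G$ has interaction depth at least $5$, and the network above uses one interaction layer more than this bound. -/

import Mathlib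

/-! ### Grid graphs and the order `r*` -/

/-- Vertices of the `d 0 × ⋯ × d (k-1)` grid: points `x` with `0 ≤ x i < d i`. -/
abbrev GridVertex {k : ℕ} (d : Fin k → ℕ) : Type := (i : Fin k) → Fin (d i)

/-- `y` is obtained from `x` by increasing coordinate `i` by one: `y = x + e_i`. -/
def IsStep {k : ℕ} {d : Fin k → ℕ} (i : Fin k) (x y : GridVertex d) : Prop :=
  (x i : ℕ) + 1 = (y i : ℕ) ∧ ∀ j, j ≠ i → x j = y j

/-- The grid graph, i.e. the product of the path graphs on `d i` vertices. -/
def gridGraph {k : ℕ} (d : Fin k → ℕ) : SimpleGraph (GridVertex d) :=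
  SimpleGraph.fromRel (fun x y => ∃ i, IsStep i x y)

/-- The coordinate sum. The diagonal `V_i` is the set of vertices of level `i`. -/
def level {k : ℕ} {d : Fin k → ℕ} (x : GridVertex d) : ℕ := ∑ i, (x i : ℕ)

/-- The strict order `r*`: smaller coordinate sum first and, inside a diagonal, the
lexicographically larger point first. -/
def RStarLT {k : ℕ} {d : Fin k → ℕ} (x y : GridVertex d) : Prop :=
  level x < level y ∨
    (level x = level y ∧ ∃ i, (∀ j, j < i → x j = y j) ∧ y i < x i)

/-! ### Hubbard Hamiltonians and their interaction graphs -/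

/-- The summands (up to a nonzero coefficient) of a Hubbard Hamiltonian with set of
occupancy states `V`: `n_p`, `n_p n_q` and `a_p† a_q + a_q† a_p`. -/
inductive HamiltonianTerm (V : Type) : Type
  | number (p : V) : HamiltonianTerm V
  | repulsion (p q : V) : HamiltonianTerm V
  | hopping (p q : V) : HamiltonianTerm V

/-- Two distinct occupancy states are joined if some summand involves both of them. -/
def interactionGraph {V : Type} (H : Set (HamiltonianTerm V)) : SimpleGraph V :=
  SimpleGraph.fromRel
    (fun p q => HamiltonianTerm.repulsion p q ∈ H ∨ HamiltonianTerm.hopping p q ∈ H)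

/-- The spinless `M × N` Hubbard model: one occupancy state for each site `(m, n)`;
`U ∑ n_p - t ∑ (a_p† a_q + a_q† a_p)` with the second sum over the edges `(p, q)` of the
`M × N` grid. -/
def spinlessHubbard (M N : ℕ) : Set (HamiltonianTerm (GridVertex ![M, N])) :=
  {T | (∃ p, T = .number p) ∨ (∃ p q i, IsStep i p q ∧ T = .hopping p q)}

/-- The `M × N` Hubbard model with spin: occupancy states `(σ, m, n)` with spin
`σ ∈ {0, 1}` (`1` is spin up); `n_p n_q` for the two states `q`, `p` of one site (so
that `p = q + e_0`), and a hopping term for equal spins and neighbouring sites. -/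
def spinHubbard (M N : ℕ) : Set (HamiltonianTerm (GridVertex ![2, M, N])) :=
  {T | (∃ p q, IsStep 0 q p ∧ T = .repulsion p q) ∨
    (∃ p q, (IsStep 1 p q ∨ IsStep 2 p q) ∧ T = .hopping p q)}

theorem interactionGraph_spinlessHubbard (M N : ℕ) :
    interactionGraph (spinlessHubbard M N) = gridGraph ![M, N] := by
  ext p q
  simp [interactionGraph, gridGraph, spinlessHubbard, SimpleGraph.fromRel_adj]

theorem interactionGraph_spinHubbard (M N : ℕ) :
    interactionGraph (spinHubbard M N) = gridGraph ![2, M, N] := by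
  ext p q
  simp only [interactionGraph, gridGraph, spinHubbard, SimpleGraph.fromRel_adj,
    Set.mem_ofPred_eq, Fin.exists_fin_succ]
  simp
  tauto

/-! ### Swap networks on a line of qubits -/

/-- In the order `r` the vertices `u` and `v` occupy consecutive positions. -/
def AdjacentIn {V : Type} {n : ℕ} (r : V ≃ Fin n) (u v : V) : Prop :=
  (r u : ℕ) + 1 = (r v : ℕ) ∨ (r v : ℕ) + 1 = (r u : ℕ)

/-- `r'` arises from `r` by one swap layer: some pairwise disjoint pairs of vertices in
consecutive positions are exchanged, all other vertices stay where they are. -/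
def IsSwapLayer {V : Type} {n : ℕ} (r r' : V ≃ Fin n) : Prop :=
  ∀ v, r' v = r v ∨ ∃ w, AdjacentIn r v w ∧ r' v = r w ∧ r' w = r v

/-- A linear-connectivity swap network for `G`. The vertices are put on a line in the
order `order 0`; the `t`-th swap layer turns `order t` into `order (t + 1)`. The `l`-th
interaction layer is performed after the first `time l` swap layers, on a set `pairs l` of
pairwise disjoint edges of `G` whose ends are then in consecutive positions. Every edge
of `G` is performed exactly once. (Values of `order`, `time`, `pairs` beyond the depths
play no role.) -/
structure SwapNetwork {V : Type} [Fintype V] (G : SimpleGraph V) where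
  /-- number of swap layers -/
  swapDepth : ℕ
  order : ℕ → V ≃ Fin (Fintype.card V)
  swap_layer : ∀ t, t < swapDepth → IsSwapLayer (order t) (order (t + 1))
  /-- number of interaction layers -/
  interactionDepth : ℕ
  time : ℕ → ℕ
  time_le : ∀ l, l < interactionDepth → time l ≤ swapDepth
  time_mono : ∀ l l', l ≤ l' → l' < interactionDepth → time l ≤ time l'
  pairs : ℕ → Set (Sym2 V)
  pairs_subset : ∀ l, l < interactionDepth → pairs l ⊆ G.edgeSet
  pairs_adjacent : ∀ l, l < interactionDepth → ∀ u v, s(u, v) ∈ pairs l →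
    AdjacentIn (order (time l)) u v
  pairs_disjoint : ∀ l, l < interactionDepth → ∀ u v w, s(u, v) ∈ pairs l →
    s(u, w) ∈ pairs l → v = w
  complete : ∀ e, e ∈ G.edgeSet → ∃! l, l < interactionDepth ∧ e ∈ pairs l

/-- `d_swap(G)`: the minimum swap depth over all swap networks for `G`. -/
noncomputable def minSwapDepth {V : Type} [Fintype V] (G : SimpleGraph V) : ℕ :=
  sInf {D | ∃ W : SwapNetwork G, W.swapDepth = D}

/-- The minimum interaction depth over all swap networks for `G`. -/
noncomputable def minInteractionDepth {V : Type} [Fintype V] (G : SimpleGraph V) : ℕ :=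
  sInf {L | ∃ W : SwapNetwork G, W.interactionDepth = L}

/-- The degree of a graph, i.e. the maximum of its vertex degrees. -/
noncomputable def graphDegree {V : Type} [Fintype V] (G : SimpleGraph V) : ℕ := by
  classical exact G.maxDegree

/-! ### The diagonal-interleaving scheme -/

/-- `r` interlaces the order `r^o` of the odd diagonals with the order `r^e` of the even
ones (both are restrictions of `r*`) in such a way that each odd vertex `v` is adjacent to
its up to two neighbours in the corresponding row of the preceding even diagonal. A row of
a diagonal consists of its points with given first `k - 2` coordinates, so these
neighbours are `v - e_i` for the last two coordinates `i`. -/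
structure IsInterlacing {k : ℕ} {d : Fin k → ℕ}
    (r : GridVertex d ≃ Fin (Fintype.card (GridVertex d))) : Prop where
  odd_order : ∀ u v, Odd (level u) → Odd (level v) → (r u < r v ↔ RStarLT u v)
  even_order : ∀ u v, Even (level u) → Even (level v) → (r u < r v ↔ RStarLT u v)
  adjacent : ∀ (u v : GridVertex d) (i : Fin k), Odd (level v) → k ≤ (i : ℕ) + 2 →
    IsStep i u v → AdjacentIn r u v

/-- The interlacing in which the odd vertices have the rightmost possible positions. -/
def IsRightmostInterlacing {k : ℕ} {d : Fin k → ℕ}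
    (r : GridVertex d ≃ Fin (Fintype.card (GridVertex d))) : Prop :=
  IsInterlacing r ∧
    ∀ r' : GridVertex d ≃ Fin (Fintype.card (GridVertex d)), IsInterlacing r' →
      ∀ v, Odd (level v) → r' v ≤ r v

/-- The interactions of stage `l < 2 * k`. Each odd vertex `v` interacts successively with
`v - e_{k-1}, v - e_{k-2}, …, v - e_0, v + e_0, …, v + e_{k-2}, v + e_{k-1}`, as far as
these exist. -/
def stagePairs {k : ℕ} (d : Fin k → ℕ) (l : ℕ) : Set (Sym2 (GridVertex d)) :=
  {e | ∃ (u v : GridVertex d) (i : Fin k), Odd (level v) ∧ e = s(u, v) ∧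
    ((l + 1 + (i : ℕ) = k ∧ IsStep i u v) ∨ (l = k + (i : ℕ) ∧ IsStep i v u))}

/-- The network follows the diagonal-interleaving scheme: it starts with the rightmost
interlacing, the swaps shift the odd diagonals upward past the even ones, and there are
`2 * k` interaction layers, one for each stage. -/
structure SwapNetwork.IsDiagonalInterleaving {k : ℕ} {d : Fin k → ℕ}
    {G : SimpleGraph (GridVertex d)} (W : SwapNetwork G) : Prop where
  initial : IsRightmostInterlacing (W.order 0)
  odd_upward : ∀ t, t < W.swapDepth → ∀ v, Odd (level v) → W.order t v ≤ W.order (t + 1) v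
  even_downward : ∀ t, t < W.swapDepth → ∀ v, Even (level v) →
    W.order (t + 1) v ≤ W.order t v
  stages : W.interactionDepth = 2 * k
  pairs_eq : ∀ l, l < 2 * k → W.pairs l = stagePairs d l

/-! Lower bound for the swaps. A vertex moves at most one position per swap layer, so in an order
halfway through a network of swap depth `D` the ends of every edge are still close together. Hence
every initial segment of that order has outer boundary at most `D + 1`; for odd `D` this needs an
extra argument about the middle layer (`SwapNetwork.exists_order_boundary_le`). On the other hand,
let `G` contain the product of `K_s` with an `M × N` grid, where `2 ≤ M ≤ N`. In every linear order,
consider the moment when an initial segment first contains a whole row or column of one layer: at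
that moment or just before it, the boundary has size at least `s * M`
(`IsLayeredGrid.exists_boundary`). Taking `s = 1` and `s = 2` gives `M - 1` and `2 * M - 1`.

Construction. Embed the grid in a strip that is infinite in the last direction. There the even
vertices occupy the even integers and the odd vertices the odd integers, each class in the order
`r*`, and one swap layer raises all odd keys by 2. The index difference between an odd vertex and a
neighbour depends only on the direction, so all edges of one stage become adjacent at the same time.
Ranking the finitely many grid vertices by key preserves adjacency of consecutive keys and turns
each shift into a swap layer (`rankEquiv_shift`, `stripNetwork`). The initial order is rightmost
because every "odd before even" relation in it holds in all interlacings (`forced₂`, `forced₃`).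

Interaction depth is bounded below by the degree, since the edges at a vertex lie in different
layers. -/

/-! ### Lower bound for the swap depth -/

/-- The outer vertex boundary of a set of vertices. -/
def outerBoundary {V : Type} (G : SimpleGraph V) (S : Set V) : Set V :=
  {v | v ∉ S ∧ ∃ u ∈ S, G.Adj u v}

theorem IsSwapLayer.dist_le {V : Type} {n : ℕ} {r r' : V ≃ Fin n} (h : IsSwapLayer r r')
    (v : V) : |((r' v : ℕ) : ℤ) - (r v : ℕ)| ≤ 1 := by
  rcases h v with h | ⟨w, ha, h, -⟩
  · simp [h]
  · rw [h, abs_le]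
    rcases ha with ha | ha <;> omega

namespace SwapNetwork

variable {V : Type} [Fintype V] {G : SimpleGraph V} (W : SwapNetwork G)

theorem dist_order_le {s t : ℕ} (hst : s ≤ t) (ht : t ≤ W.swapDepth) (v : V) :
    |((W.order t v : ℕ) : ℤ) - (W.order s v : ℕ)| ≤ t - s := by
  induction t, hst using Nat.le_induction with
  | base => simp
  | succ t hst ih =>
    have h₁ := ih (by omega)
    have h₂ := (W.swap_layer t (by omega)).dist_le v
    rw [abs_le] at *
    push_cast
    constructor <;> linarith [h₁.1, h₁.2, h₂.1, h₂.2]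

theorem exists_time_of_adj {u v : V} (h : G.Adj u v) :
    ∃ t ≤ W.swapDepth, |((W.order t u : ℕ) : ℤ) - (W.order t v : ℕ)| = 1 := by
  obtain ⟨l, ⟨hl, he⟩, -⟩ := W.complete s(u, v) h
  refine ⟨W.time l, W.time_le l hl, ?_⟩
  rw [abs_eq zero_le_one]
  rcases W.pairs_adjacent l hl u v he with h | h <;> omega

/-- Both ends may drift by one position per layer away from the time of their interaction, whence
the factor 2. -/
theorem dist_order_le_of_adj {u v : V} (h : G.Adj u v) :
    ∃ t ≤ W.swapDepth, ∀ s ≤ W.swapDepth,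
      |((W.order s u : ℕ) : ℤ) - (W.order s v : ℕ)| ≤ 1 + 2 * |(t : ℤ) - s| := by
  obtain ⟨t, ht, hd⟩ := W.exists_time_of_adj h
  refine ⟨t, ht, fun s hs => ?_⟩
  have move : ∀ x, |((W.order t x : ℕ) : ℤ) - (W.order s x : ℕ)| ≤ |(t : ℤ) - s| := by
    intro x
    rcases le_total s t with h' | h'
    · exact (W.dist_order_le h' ht x).trans (le_abs_self _)
    · rw [abs_sub_comm, abs_sub_comm (t : ℤ)]
      exact (W.dist_order_le h' hs x).trans (le_abs_self _)
  have hu := move u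
  have hv := move v
  rw [abs_le] at hu hv ⊢
  have hd' := abs_le.1 hd.le
  constructor <;> linarith [hu.1, hu.2, hv.1, hv.2, hd'.1, hd'.2]

/-- In the order in the middle of a swap network, every initial segment has an outer
boundary whose size exceeds the swap depth by at most one. -/
theorem exists_order_boundary_le :
    ∃ r : V ≃ Fin (Fintype.card V), ∀ m : ℕ,
      (outerBoundary G {v | (r v : ℕ) < m}).ncard ≤ W.swapDepth + 1 := by
  obtain ⟨s, hs⟩ := Nat.even_or_odd' W.swapDepth
  have hsD : s ≤ W.swapDepth := by omega
  refine ⟨W.order s, fun m => ?_⟩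
  set r := W.order s with hr
  have bound : ∀ (B : Set V) (T : Finset ℕ), (∀ v ∈ B, (r v : ℕ) ∈ T) → B.ncard ≤ T.card := by
    intro B T hB
    rw [← Set.ncard_coe_finset T]
    refine Set.ncard_le_ncard_of_injOn (fun v => (r v : ℕ)) (fun v hv => hB v hv) ?_
      T.finite_toSet
    intro a _ b _ hab
    exact r.injective (Fin.ext hab)
  rcases hs with hD | hD
  -- Even depth `2 * s`: no interaction is more than `s` layers away from the middle, so edges have
  -- length at most `2 * s + 1` there.
  · refine (bound _ (Finset.Icc m (m + W.swapDepth)) ?_).trans (by simp; omega)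
    rintro v ⟨hv, u, hu, ha⟩
    obtain ⟨t, ht, hd⟩ := W.dist_order_le_of_adj ha
    have : |(t : ℤ) - s| ≤ s := by rw [abs_le]; constructor <;> omega
    have hd' := abs_le.1 ((hd s hsD).trans (by linarith : _ ≤ 1 + 2 * (s : ℤ)))
    simp only [← hr] at hd'
    simp only [Set.mem_ofPred_eq] at hu hv
    rw [Finset.mem_Icc]
    omega
  · have hsD' : s + 1 ≤ W.swapDepth := by omega
    set r' := W.order (s + 1) with hr'
    have hlay : IsSwapLayer r r' := W.swap_layer s (by omega)
    -- Odd depth `2 * s + 1`: an edge is short in `r` if it interacts by time `s`, and short in `r'`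
    -- otherwise.
    have hadj : ∀ u v, G.Adj u v →
        |((r u : ℕ) : ℤ) - (r v : ℕ)| ≤ W.swapDepth ∨
          |((r' u : ℕ) : ℤ) - (r' v : ℕ)| ≤ W.swapDepth := by
      intro u v ha
      obtain ⟨t, ht, hd⟩ := W.dist_order_le_of_adj ha
      rcases Nat.lt_or_ge s t with h | h
      · right
        refine (hd (s + 1) hsD').trans ?_
        rw [abs_of_nonneg (by push_cast; omega)]
        push_cast; omega
      · left
        refine (hd s hsD).trans ?_
        rw [abs_of_nonpos (by omega)]
        omega
    have move : ∀ v, (r' v : ℕ) ≤ r v + 1 ∧ (r v : ℕ) ≤ r' v + 1 := by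
      intro v
      have := abs_le.1 (hlay.dist_le v)
      omega
    -- The bounds so far allow one position too many. If all of them were filled, the vertices in
    -- the last two would both be on long edges of `r`, hence on short edges of `r'`. The last
    -- vertex must then step down and push the other one up, out of reach of its neighbour.
    by_contra hcon
    have hsub : ∀ v ∈ outerBoundary G {v | (r v : ℕ) < m},
        (r v : ℕ) ∈ Finset.Icc m (m + W.swapDepth + 1) := by
      rintro v ⟨hv, u, hu, ha⟩
      simp only [Set.mem_ofPred_eq] at hu hv
      have hu' := move u
      have hv' := move v
      rw [Finset.mem_Icc]
      rcases hadj u v ha with h | h <;> (rw [abs_le] at h; omega)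
    have hall : ∀ p, m ≤ p → p ≤ m + W.swapDepth + 1 →
        ∃ v ∈ outerBoundary G {v | (r v : ℕ) < m}, (r v : ℕ) = p := by
      intro p hp hp'
      by_contra! hne
      have := bound (outerBoundary G {v | (r v : ℕ) < m})
        ((Finset.Icc m (m + W.swapDepth + 1)).erase p)
        (fun v hv => Finset.mem_erase.2 ⟨hne v hv, hsub v hv⟩)
      rw [Finset.card_erase_of_mem (Finset.mem_Icc.2 ⟨hp, hp'⟩), Nat.card_Icc] at this
      omega
    obtain ⟨v, ⟨-, u, hu, hau⟩, hv⟩ := hall (m + W.swapDepth + 1) (by omega) le_rfl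
    obtain ⟨w, ⟨-, u', hu', haw⟩, hw⟩ := hall (m + W.swapDepth) (by omega) (by omega)
    simp only [Set.mem_ofPred_eq] at hu hu'
    have m1 := move u
    have m2 := move u'
    have m3 := move v
    have hv' : (r' v : ℕ) = m + W.swapDepth := by
      rcases hadj u v hau with h | h <;> (rw [abs_le] at h; omega)
    have hw' : (r' w : ℕ) ≤ m + W.swapDepth := by
      rcases hadj u' w haw with h | h <;> (rw [abs_le] at h; omega)
    rcases hlay v with h | ⟨x, -, h₁, h₂⟩
    · rw [h] at hv'; omega
    · have : x = w := r.injective (Fin.ext (by rw [← h₁]; omega))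
      subst this
      rw [h₂] at hw'
      omega

end SwapNetwork

/-! ### Vertex isoperimetry in layered grids. -/

theorem Fin.exists_succ_of_mixed {n : ℕ} (p : Fin n → Prop) {a b : Fin n} (ha : p a)
    (hb : ¬ p b) : ∃ i j : Fin n, p i ∧ ¬ p j ∧
      ((i : ℕ) + 1 = j ∨ (j : ℕ) + 1 = i) := by
  by_contra! h
  have up : ∀ t (i : Fin n), p i → ∀ j : Fin n, (j : ℕ) = i + t → p j := by
    intro t
    induction t with
    | zero =>
      intro i hi j hj
      rwa [show j = i from Fin.ext (by omega)]
    | succ t ih =>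
      intro i hi j hj
      by_contra hpj
      exact (h ⟨i + t, by omega⟩ j (ih i hi _ rfl) hpj).1 (by simp; omega)
  have down : ∀ t (i : Fin n), p i → ∀ j : Fin n, (j : ℕ) + t = i → p j := by
    intro t
    induction t with
    | zero =>
      intro i hi j hj
      rwa [show j = i from Fin.ext (by omega)]
    | succ t ih =>
      intro i hi j hj
      by_contra hpj
      exact (h ⟨j + 1, by omega⟩ j (ih i hi _ (by simp; omega)) hpj).2 rfl
  rcases le_total a b with hab | hab
  · exact hb (up (b - a) a ha b (by omega))
  · exact hb (down (a - b) a ha b (by omega))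

section Isoperimetry

variable {V : Type} {G : SimpleGraph V} {s M N : ℕ}

/-- `f` embeds the product of a complete graph and two paths into `G`. -/
structure IsLayeredGrid (G : SimpleGraph V) (f : Fin s → Fin M → Fin N → V) : Prop where
  inj : ∀ σ i j σ' i' j', f σ i j = f σ' i' j' → σ = σ' ∧ i = i' ∧ j = j'
  layer : ∀ σ σ' i j, σ ≠ σ' → G.Adj (f σ i j) (f σ' i j)
  fst : ∀ σ (i i' : Fin M) j, (i : ℕ) + 1 = i' → G.Adj (f σ i j) (f σ i' j)
  snd : ∀ σ i (j j' : Fin N), (j : ℕ) + 1 = j' → G.Adj (f σ i j) (f σ i j')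

theorem IsLayeredGrid.swap {f : Fin s → Fin M → Fin N → V} (h : IsLayeredGrid G f) :
    IsLayeredGrid G (fun σ j i => f σ i j) where
  inj σ j i σ' j' i' e := by
    obtain ⟨h₁, h₂, h₃⟩ := h.inj _ _ _ _ _ _ e
    exact ⟨h₁, h₃, h₂⟩
  layer σ σ' j i := h.layer σ σ' i j
  fst σ j j' i := h.snd σ i j j'
  snd σ j i i' := h.fst σ i i' j

/-- Each of the `s * N` columns contributes its own boundary vertex: a column that meets `S` has one
where it leaves `S`, and a column that misses `S` has one next to a vertex of `S` in another layer.
-/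
theorem IsLayeredGrid.le_boundary [Finite V] {f : Fin s → Fin M → Fin N → V} (h : IsLayeredGrid G f)
    (S : Set V) (hfull : ∀ σ j, ∃ i, f σ i j ∉ S) (hne : ∀ j, ∃ σ i, f σ i j ∈ S) :
    s * N ≤ (outerBoundary G S).ncard := by
  have hex : ∀ q : Fin s × Fin N, ∃ i, f q.1 i q.2 ∈ outerBoundary G S := by
    rintro ⟨σ, j⟩
    by_cases hc : ∃ i, f σ i j ∈ S
    · obtain ⟨a, ha⟩ := hc
      obtain ⟨b, hb⟩ := hfull σ j
      obtain ⟨i, i', hi, hi', hs⟩ := Fin.exists_succ_of_mixed (fun i => f σ i j ∈ S) ha hb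
      refine ⟨i', hi', _, hi, ?_⟩
      rcases hs with hs | hs
      · exact h.fst σ i i' j hs
      · exact (h.fst σ i' i j hs).symm
    · push Not at hc
      obtain ⟨σ', i, hi⟩ := hne j
      refine ⟨i, hc i, _, hi, h.layer _ _ _ _ ?_⟩
      rintro rfl
      exact hc i hi
  choose g hg using hex
  have hcard : s * N = (Set.univ : Set (Fin s × Fin N)).ncard := by
    simp [Set.ncard_univ]
  rw [hcard]
  refine Set.ncard_le_ncard_of_injOn (fun q => f q.1 (g q) q.2) (fun q _ => hg q) ?_
    (Set.toFinite _)
  rintro ⟨σ, j⟩ _ ⟨σ', j'⟩ _ e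
  obtain ⟨h₁, -, h₃⟩ := h.inj _ _ _ _ _ _ e
  exact Prod.ext h₁ h₃

theorem IsLayeredGrid.le_boundary_insert
    [Finite V] {f : Fin s → Fin M → Fin N → V}
    (h : IsLayeredGrid G f) (hM : 2 ≤ M) (S : Set V) (x : V)
    (hrow : ∀ σ i, ∃ j, f σ i j ∉ S) (hcol : ∀ σ j, ∃ i, f σ i j ∉ S)
    (hx : ∃ σ i, ∀ j, f σ i j ∈ insert x S) :
    s * N ≤ (outerBoundary G S).ncard ∨ s * N ≤ (outerBoundary G (insert x S)).ncard := by
  obtain ⟨σ₀, i₀, hfull⟩ := hx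
  by_cases hc : ∀ σ j, ∃ i, f σ i j ∉ insert x S
  · exact Or.inr (h.le_boundary _ hc fun j => ⟨σ₀, i₀, hfull j⟩)
  · left
    push Not at hc
    obtain ⟨σ₁, j₁, hc⟩ := hc
    obtain ⟨i₁, hi₁⟩ := hcol σ₁ j₁
    obtain ⟨j₀, hj₀⟩ := hrow σ₀ i₀
    have e₁ : f σ₁ i₁ j₁ = x := (hc i₁).resolve_right hi₁
    have e₀ : f σ₀ i₀ j₀ = x := (hfull j₀).resolve_right hj₀
    -- Neither the full row nor the full column was full before `x` was added, so `x` is their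
    -- crossing and they share a layer.
    obtain ⟨rfl, rfl, rfl⟩ := h.inj _ _ _ _ _ _ (e₁.trans e₀.symm)
    refine h.le_boundary _ hcol fun j => ⟨σ₁, ?_⟩
    -- Without `x`, the row still meets all other columns, and the column of `x` keeps another
    -- vertex because `2 ≤ M`.
    by_cases hj : j = j₁
    · subst hj
      obtain ⟨i, hi⟩ : ∃ i : Fin M, i ≠ i₁ := by
        have : Nontrivial (Fin M) := Fin.nontrivial_iff_two_le.2 hM
        exact exists_ne i₁
      refine ⟨i, (hc i).resolve_left fun e => hi ?_⟩
      exact (h.inj _ _ _ _ _ _ (e.trans e₁.symm)).2.1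
    · refine ⟨i₁, (hfull j).resolve_left fun e => hj ?_⟩
      exact (h.inj _ _ _ _ _ _ (e.trans e₁.symm)).2.2

theorem IsLayeredGrid.exists_boundary [Finite V] {f : Fin s → Fin M → Fin N → V}
    (h : IsLayeredGrid G f) (hs : 0 < s) (hM : 2 ≤ M) (hMN : M ≤ N) {n : ℕ} (r : V ≃ Fin n) :
    ∃ m : ℕ, s * M ≤ (outerBoundary G {v | (r v : ℕ) < m}).ncard := by
  classical
  -- The critical moment is the least `m` for which some layer has a complete row or column in the
  -- segment.
  let P : ℕ → Prop := fun m =>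
    (∃ σ i, ∀ j, f σ i j ∈ {v | (r v : ℕ) < m}) ∨ (∃ σ j, ∀ i, f σ i j ∈ {v | (r v : ℕ) < m})
  have hP : ∃ m, P m := ⟨n, Or.inl ⟨⟨0, hs⟩, ⟨0, by omega⟩, fun j => (r _).2⟩⟩
  have h0 : ¬ P 0 := by
    rintro (⟨σ, i, hj⟩ | ⟨σ, j, hi⟩)
    · exact absurd (hj ⟨0, by omega⟩) (by simp)
    · exact absurd (hi ⟨0, by omega⟩) (by simp)
  obtain ⟨m, hm⟩ : ∃ m, Nat.find hP = m + 1 :=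
    Nat.exists_eq_succ_of_ne_zero fun e => h0 (e ▸ Nat.find_spec hP)
  have hnot : ¬ P m := Nat.find_min hP (by omega)
  have hyes : P (m + 1) := hm ▸ Nat.find_spec hP
  have hmn : m < n := by
    by_contra hge
    refine hnot (Or.inl ⟨⟨0, hs⟩, ⟨0, by omega⟩, fun j => ?_⟩)
    exact lt_of_lt_of_le (r _).2 (by omega)
  have hins : {v | (r v : ℕ) < m + 1} = insert (r.symm ⟨m, hmn⟩) {v | (r v : ℕ) < m} := by
    ext v
    simp only [Set.mem_ofPred_eq, Set.mem_insert_iff, Equiv.eq_symm_apply, Fin.ext_iff]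
    omega
  simp only [P] at hnot hyes
  rw [hins] at hyes
  push Not at hnot
  obtain ⟨hrow, hcol⟩ := hnot
  have hle : s * M ≤ s * N := Nat.mul_le_mul_left s hMN
  rcases hyes with hx | hx
  · rcases h.le_boundary_insert hM _ _ hrow hcol hx with hb | hb
    · exact ⟨m, hle.trans hb⟩
    · exact ⟨m + 1, by rw [hins]; exact hle.trans hb⟩
  · rcases h.swap.le_boundary_insert (hM.trans hMN) _ _ hcol hrow hx with hb | hb
    · exact ⟨m, hb⟩
    · exact ⟨m + 1, by rw [hins]; exact hb⟩

end Isoperimetry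

theorem SwapNetwork.le_swapDepth_of_isLayeredGrid {V : Type} [Fintype V] {G : SimpleGraph V}
    {s M N : ℕ} {f : Fin s → Fin M → Fin N → V} (h : IsLayeredGrid G f) (hs : 0 < s)
    (hM : 2 ≤ M) (hMN : M ≤ N) (W : SwapNetwork G) : s * M ≤ W.swapDepth + 1 := by
  obtain ⟨r, hr⟩ := W.exists_order_boundary_le
  obtain ⟨m, hm⟩ := h.exists_boundary hs hM hMN r
  exact hm.trans (hr m)

/-! ### Ranks and shifts -/

section Rank

variable {V : Type} [Fintype V]

theorem card_filter_lt_strictMono (κ : V → ℤ) {u v : V} (h : κ u < κ v) :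
    (Finset.univ.filter fun y => κ y < κ u).card < (Finset.univ.filter fun y => κ y < κ v).card := by
  refine Finset.card_lt_card ?_
  rw [Finset.ssubset_iff_of_subset]
  · exact ⟨u, by simp [h], by simp⟩
  · intro y hy
    simp only [Finset.mem_filter, Finset.mem_univ, true_and] at hy ⊢
    exact hy.trans h

/-- The linear order of the vertices by the values of an injective key. -/
noncomputable def rankEquiv (κ : V → ℤ) (hκ : Function.Injective κ) :
    V ≃ Fin (Fintype.card V) :=
  Equiv.ofBijective
    (fun x => ⟨(Finset.univ.filter fun y => κ y < κ x).card, by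
      refine Finset.card_lt_univ_of_notMem (x := x) ?_
      simp⟩)
    ((Fintype.bijective_iff_injective_and_card _).2 ⟨by
      intro u v huv
      rw [Fin.mk.injEq] at huv
      refine hκ (le_antisymm ?_ ?_) <;> by_contra hlt <;> rw [not_le] at hlt <;>
        have := card_filter_lt_strictMono κ hlt <;> omega, by simp⟩)

variable {κ : V → ℤ} (hκ : Function.Injective κ)

theorem rankEquiv_val (x : V) :
    (rankEquiv κ hκ x : ℕ) = (Finset.univ.filter fun y => κ y < κ x).card := rfl

theorem rankEquiv_lt_iff (u v : V) : rankEquiv κ hκ u < rankEquiv κ hκ v ↔ κ u < κ v := by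
  rw [Fin.lt_def, rankEquiv_val, rankEquiv_val]
  refine ⟨fun h => ?_, card_filter_lt_strictMono κ⟩
  by_contra hge
  rcases (not_lt.1 hge).lt_or_eq with h' | h'
  · have := card_filter_lt_strictMono κ h'
    omega
  · rw [h'] at h
    omega

/-- Integer keys leave no room between consecutive values. Adjacency in the infinite strip therefore
survives restriction to the grid, however many strip positions are vacant. -/
theorem rankEquiv_succ {u v : V} (h : κ u + 1 = κ v) :
    (rankEquiv κ hκ u : ℕ) + 1 = rankEquiv κ hκ v := by
  classical
  rw [rankEquiv_val, rankEquiv_val]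
  have : (Finset.univ.filter fun y => κ y < κ v) =
      insert u (Finset.univ.filter fun y => κ y < κ u) := by
    ext y
    simp only [Finset.mem_filter, Finset.mem_univ, true_and, Finset.mem_insert]
    constructor
    · intro hy
      by_cases e : κ y = κ u
      · exact Or.inl (hκ e)
      · right; omega
    · rintro (rfl | hy) <;> omega
  rw [this, Finset.card_insert_of_notMem (by simp)]

/-- Vertices with `p = 1` have odd keys, and they all move past the even key that follows
theirs; vertices with `p = 0` have even keys. -/
theorem rankEquiv_shift {p : V → ℕ} {κ' : V → ℤ} (hκ' : Function.Injective κ')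
    (hp : ∀ v, p v < 2) (hpar : ∀ v, κ v % 2 = p v) (hs : ∀ v, κ' v = κ v + 2 * p v) :
    IsSwapLayer (rankEquiv κ hκ) (rankEquiv κ' hκ') ∧
    (∀ v, p v = 1 → rankEquiv κ hκ v ≤ rankEquiv κ' hκ' v) ∧
    (∀ v, p v = 0 → rankEquiv κ' hκ' v ≤ rankEquiv κ hκ v) := by
  classical
  have hodd : ∀ v w, p v = 1 → κ w = κ v + 1 →
      (rankEquiv κ' hκ' v = rankEquiv κ hκ w ∧ rankEquiv κ' hκ' w = rankEquiv κ hκ v) := by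
    intro v w hv hw
    have hpv := hpar v
    have hpw := hpar w
    have h1 : (rankEquiv κ' hκ' w : ℕ) = rankEquiv κ hκ v := by
      rw [rankEquiv_val, rankEquiv_val]
      congr 1
      ext y
      have h1 := hpar y
      have h2 := hs y
      have h3 := hs w
      have h4 := hp y
      simp only [Finset.mem_filter, Finset.mem_univ, true_and]
      omega
    have h2 := rankEquiv_succ hκ hw.symm
    have h3 := rankEquiv_succ hκ' (u := w) (v := v) (by rw [hs, hs]; omega)
    exact ⟨Fin.ext (by omega), Fin.ext h1⟩
  -- If the next strip position is vacant, the odd vertex moves past nothing and its rank does not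
  -- change.
  have hfix : ∀ v, p v = 1 → (∀ w, κ w ≠ κ v + 1) →
      rankEquiv κ' hκ' v = rankEquiv κ hκ v := by
    intro v hv hw
    apply Fin.ext
    rw [rankEquiv_val, rankEquiv_val]
    congr 1
    ext y
    have h1 := hpar y
    have h2 := hs y
    have h3 := hs v
    have h4 := hp y
    have h5 := hpar v
    have h6 := hw y
    simp only [Finset.mem_filter, Finset.mem_univ, true_and]
    omega
  have hfix' : ∀ w, p w = 0 → (∀ v, κ w ≠ κ v + 1) →
      rankEquiv κ' hκ' w = rankEquiv κ hκ w := by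
    intro w hw hv
    apply Fin.ext
    rw [rankEquiv_val, rankEquiv_val]
    congr 1
    ext y
    have h1 := hpar y
    have h2 := hs y
    have h3 := hs w
    have h4 := hp y
    have h5 := hpar w
    have h6 := hv y
    simp only [Finset.mem_filter, Finset.mem_univ, true_and]
    omega
  have hup : ∀ v, p v = 1 → rankEquiv κ' hκ' v = rankEquiv κ hκ v ∨
      ∃ w, κ w = κ v + 1 := by
    intro v hv
    by_cases h : ∃ w, κ w = κ v + 1
    · exact Or.inr h
    · push Not at h
      exact Or.inl (hfix v hv h)
  have hdown : ∀ w, p w = 0 → rankEquiv κ' hκ' w = rankEquiv κ hκ w ∨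
      ∃ v, p v = 1 ∧ κ w = κ v + 1 := by
    intro w hw
    by_cases h : ∃ v, κ w = κ v + 1
    · obtain ⟨v, h⟩ := h
      have h1 := hpar w
      have h2 := hpar v
      exact Or.inr ⟨v, by omega, h⟩
    · push Not at h
      exact Or.inl (hfix' w hw h)
  refine ⟨fun v => ?_, fun v hv => ?_, fun w hw => ?_⟩
  · rcases (show p v = 1 ∨ p v = 0 by have := hp v; omega) with hv | hv
    · rcases hup v hv with h | ⟨w, hw⟩
      · exact Or.inl h
      · exact Or.inr ⟨w, Or.inl (rankEquiv_succ hκ hw.symm), hodd v w hv hw⟩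
    · rcases hdown v hv with h | ⟨w, hw, h⟩
      · exact Or.inl h
      · exact Or.inr ⟨w, Or.inr (rankEquiv_succ hκ h.symm), (hodd w v hw h).symm⟩
  · rcases hup v hv with h | ⟨w, hw⟩
    · exact h.ge
    · rw [(hodd v w hv hw).1]
      exact ((rankEquiv_lt_iff hκ v w).2 (by omega)).le
  · rcases hdown w hw with h | ⟨v, hv, h⟩
    · exact h.le
    · rw [(hodd v w hv h).2]
      exact ((rankEquiv_lt_iff hκ v w).2 (by omega)).le

end Rank

/-! ### Steps in a grid -/

section Steps

variable {k : ℕ} {d : Fin k → ℕ}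

theorem IsStep.sum_eq {R : Type} [CommRing R] (c : Fin k → R) {i : Fin k} {x y : GridVertex d}
    (h : IsStep i x y) : ∑ j, c j * ((y j : ℕ) : R) = ∑ j, c j * ((x j : ℕ) : R) + c i := by
  classical
  rw [← Finset.add_sum_erase _ _ (Finset.mem_univ i),
    ← Finset.add_sum_erase Finset.univ (fun j => c j * ((x j : ℕ) : R)) (Finset.mem_univ i),
    ← h.1, Finset.sum_congr rfl (fun j hj => by rw [← h.2 j (Finset.ne_of_mem_erase hj)])]
  push_cast
  ring

theorem IsStep.level_eq {i : Fin k} {x y : GridVertex d} (h : IsStep i x y) :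
    level y = level x + 1 := by
  have := h.sum_eq (fun _ => (1 : ℤ))
  simp only [one_mul] at this
  unfold level
  exact_mod_cast this

theorem IsStep.right_unique {i : Fin k} {x y z : GridVertex d} (h : IsStep i x y)
    (h' : IsStep i x z) : y = z := by
  funext j
  by_cases hj : j = i
  · subst hj
    exact Fin.ext (by rw [← h.1, ← h'.1])
  · rw [← h.2 j hj, ← h'.2 j hj]

theorem IsStep.left_unique {i : Fin k} {x y z : GridVertex d} (h : IsStep i x z)
    (h' : IsStep i y z) : x = y := by
  funext j
  by_cases hj : j = i
  · subst hj
    exact Fin.ext (by have := h.1; have := h'.1; omega)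
  · rw [h.2 j hj, h'.2 j hj]

theorem IsStep.index_unique {i j : Fin k} {x y : GridVertex d} (h : IsStep i x y)
    (h' : IsStep j x y) : i = j := by
  by_contra hne
  have := h.1
  rw [h'.2 i hne] at this
  omega

theorem gridGraph_adj {x y : GridVertex d} :
    (gridGraph d).Adj x y ↔ ∃ i, IsStep i x y ∨ IsStep i y x := by
  rw [gridGraph, SimpleGraph.fromRel_adj, exists_or]
  refine ⟨fun h => h.2, fun h => ⟨?_, h⟩⟩
  rintro rfl
  rcases h with ⟨i, h⟩ | ⟨i, h⟩ <;> · have := h.1; omega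

theorem rStarLT_or_of_ne {u v : GridVertex d} (h : u ≠ v) : RStarLT u v ∨ RStarLT v u := by
  rcases lt_trichotomy (level u) (level v) with hl | hl | hl
  · exact Or.inl (Or.inl hl)
  · obtain ⟨i₀, hi₀⟩ := Function.ne_iff.1 h
    obtain ⟨i, hi, hmin⟩ := wellFounded_lt.has_min {i | u i ≠ v i} ⟨i₀, hi₀⟩
    have heq : ∀ j, j < i → u j = v j := fun j hj => by
      by_contra hne
      exact hmin j hne hj
    rcases lt_or_gt_of_ne (show u i ≠ v i from hi) with hlt | hlt
    · exact Or.inr (Or.inr ⟨hl.symm, i, fun j hj => (heq j hj).symm, hlt⟩)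
    · exact Or.inl (Or.inr ⟨hl, i, heq, hlt⟩)
  · exact Or.inr (Or.inl hl)

end Steps

/-! ### The diagonal-interleaving network -/

section Interleaving

variable {k : ℕ} {d : Fin k → ℕ}

/-- The rank of `x` among the vertices of its parity in a strip that is infinite in the last
direction, up to a constant: `P` is the size of the cross-section, and increasing coordinate
`i` moves `x` down by `c i` places in its diagonal. -/
def stripIndex (P : ℕ) (c : Fin k → ℕ) (x : GridVertex d) : ℤ :=
  P * (level x / 2 : ℕ) - ∑ i, (c i : ℤ) * (x i : ℕ)

/-- The position of `x` in the infinite strip after `t` swap layers. -/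
def stripKey (P : ℕ) (c : Fin k → ℕ) (t : ℕ) (x : GridVertex d) : ℤ :=
  2 * stripIndex P c x + (level x % 2 : ℕ) * (2 * t + 1)

/-- Within each parity class the strip index gives the order `r*`. -/
def IsStripIndexing (d : Fin k → ℕ) (P : ℕ) (c : Fin k → ℕ) : Prop :=
  ∀ u v : GridVertex d, level u % 2 = level v % 2 →
    (stripIndex P c u < stripIndex P c v ↔ RStarLT u v)

variable {P : ℕ} {c : Fin k → ℕ}

/-- A step from an even level to the next odd one keeps `level / 2`, so only the in-diagonal shift
`c i` remains; a step from odd to even also gains `P`. -/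
theorem stripIndex_of_step_to_odd {i : Fin k} {u v : GridVertex d} (h : IsStep i u v)
    (hv : Odd (level v)) : stripIndex P c u = stripIndex P c v + c i := by
  have hs := h.sum_eq (fun j => (c j : ℤ))
  have hl := h.level_eq
  have : level u / 2 = level v / 2 := by rw [Nat.odd_iff] at hv; omega
  rw [stripIndex, stripIndex, hs, this]
  ring

theorem stripIndex_of_step_from_odd {i : Fin k} {u v : GridVertex d} (h : IsStep i v u)
    (hv : Odd (level v)) : stripIndex P c u = stripIndex P c v + P - c i := by
  have hs := h.sum_eq (fun j => (c j : ℤ))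
  have hl := h.level_eq
  have : level u / 2 = level v / 2 + 1 := by rw [Nat.odd_iff] at hv; omega
  rw [stripIndex, stripIndex, hs, this]
  push_cast
  ring

theorem stripKey_of_odd {t : ℕ} {v : GridVertex d} (hv : Odd (level v)) :
    stripKey P c t v = 2 * stripIndex P c v + 2 * t + 1 := by
  rw [stripKey, Nat.odd_iff.1 hv]
  push_cast
  ring

theorem stripKey_of_even {t : ℕ} {v : GridVertex d} (hv : Even (level v)) :
    stripKey P c t v = 2 * stripIndex P c v := by
  rw [stripKey, Nat.even_iff.1 hv]
  push_cast
  ring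

theorem stripKey_emod_two (t : ℕ) (v : GridVertex d) :
    stripKey P c t v % 2 = (level v % 2 : ℕ) := by
  rcases Nat.even_or_odd (level v) with h | h
  · rw [stripKey_of_even h, Nat.even_iff.1 h]
    omega
  · rw [stripKey_of_odd h, Nat.odd_iff.1 h]
    omega

theorem stripKey_injective (hc : IsStripIndexing d P c) (t : ℕ) :
    Function.Injective (stripKey (d := d) P c t) := by
  intro u v h
  have hu := stripKey_emod_two (P := P) (c := c) t u
  have hv := stripKey_emod_two (P := P) (c := c) t v
  have hpar : level u % 2 = level v % 2 := by rw [h] at hu; omega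
  have hidx : stripIndex P c u = stripIndex P c v := by
    rw [stripKey, stripKey, hpar] at h
    omega
  by_contra hne
  rcases rStarLT_or_of_ne hne with h' | h'
  · have := (hc u v hpar).2 h'
    omega
  · have := (hc v u hpar.symm).2 h'
    omega

theorem IsStep.even_left {i : Fin k} {u v : GridVertex d} (h : IsStep i u v)
    (hv : Odd (level v)) : Even (level u) := by
  have := h.level_eq
  rw [Nat.odd_iff] at hv
  rw [Nat.even_iff]
  omega

theorem IsStep.even_right {i : Fin k} {u v : GridVertex d} (h : IsStep i v u)
    (hv : Odd (level v)) : Even (level u) := by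
  have := h.level_eq
  rw [Nat.odd_iff] at hv
  rw [Nat.even_iff]
  omega

/-- The keys differ by `2 * (stripIndex P c u - stripIndex P c v - t) - 1`, which is `-1` or `1` in
the two cases. The two admissible values allow two stages at the same time. -/
theorem adjacentIn_rankEquiv_stripKey (hc : IsStripIndexing d P c) {t : ℕ}
    {u v : GridVertex d} (hu : Even (level u)) (hv : Odd (level v))
    (h : stripIndex P c u = stripIndex P c v + t ∨
      stripIndex P c u = stripIndex P c v + t + 1) :
    AdjacentIn (rankEquiv _ (stripKey_injective hc t)) u v := by
  have ku := stripKey_of_even (P := P) (c := c) (t := t) hu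
  have kv := stripKey_of_odd (P := P) (c := c) (t := t) hv
  rcases h with h | h
  · exact Or.inl (rankEquiv_succ _ (by omega))
  · exact Or.inr (rankEquiv_succ _ (by omega))

theorem AdjacentIn.symm {V : Type} {n : ℕ} {r : V ≃ Fin n} {u v : V} (h : AdjacentIn r u v) :
    AdjacentIn r v u := Or.symm h

/-- Members of a stage, with the odd vertex singled out. -/
theorem mem_stagePairs {l : ℕ} {x y : GridVertex d} :
    s(x, y) ∈ stagePairs d l ↔ ∃ i : Fin k,
      (Odd (level y) ∧ ((l + 1 + (i : ℕ) = k ∧ IsStep i x y) ∨ (l = k + (i : ℕ) ∧ IsStep i y x))) ∨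
      (Odd (level x) ∧ ((l + 1 + (i : ℕ) = k ∧ IsStep i y x) ∨ (l = k + (i : ℕ) ∧ IsStep i x y))) := by
  constructor
  · rintro ⟨u, v, i, hv, he, h⟩
    rcases Sym2.eq_iff.1 he with ⟨rfl, rfl⟩ | ⟨rfl, rfl⟩
    · exact ⟨i, Or.inl ⟨hv, h⟩⟩
    · exact ⟨i, Or.inr ⟨hv, h⟩⟩
  · rintro ⟨i, ⟨hv, h⟩ | ⟨hv, h⟩⟩
    · exact ⟨x, y, i, hv, rfl, h⟩
    · exact ⟨y, x, i, hv, Sym2.eq_swap, h⟩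

theorem stagePairs_subset (l : ℕ) : stagePairs d l ⊆ (gridGraph d).edgeSet := by
  intro e
  induction e using Sym2.ind with
  | _ x y =>
    rw [mem_stagePairs, SimpleGraph.mem_edgeSet, gridGraph_adj]
    rintro ⟨i, ⟨-, ⟨-, h⟩ | ⟨-, h⟩⟩ | ⟨-, ⟨-, h⟩ | ⟨-, h⟩⟩⟩
    · exact ⟨i, Or.inl h⟩
    · exact ⟨i, Or.inr h⟩
    · exact ⟨i, Or.inr h⟩
    · exact ⟨i, Or.inl h⟩

/-- The stage fixes the coordinate and the direction as seen from the odd end, so each vertex has at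
most one partner. -/
theorem stagePairs_disjoint {l : ℕ} {u v w : GridVertex d} (hv : s(u, v) ∈ stagePairs d l)
    (hw : s(u, w) ∈ stagePairs d l) : v = w := by
  rw [mem_stagePairs] at hv hw
  obtain ⟨i, hi⟩ := hv
  obtain ⟨j, hj⟩ := hw
  have hij : (l + 1 + (i : ℕ) = k ∧ l + 1 + (j : ℕ) = k) ∨ (l = k + (i : ℕ) ∧ l = k + (j : ℕ)) := by
    omega
  have : i = j := Fin.ext (by omega)
  subst this
  rcases hi with ⟨hp, ⟨hl, h⟩ | ⟨hl, h⟩⟩ | ⟨hp, ⟨hl, h⟩ | ⟨hl, h⟩⟩ <;>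
  rcases hj with ⟨hp', ⟨hl', h'⟩ | ⟨hl', h'⟩⟩ | ⟨hp', ⟨hl', h'⟩ | ⟨hl', h'⟩⟩ <;>
  first
  | exact h.right_unique h'
  | exact h.left_unique h'
  | omega
  | (exfalso
     have e := h.level_eq
     have e' := h'.level_eq
     rw [Nat.odd_iff] at hp hp'
     omega)

theorem exists_mem_stagePairs {e : Sym2 (GridVertex d)} (he : e ∈ (gridGraph d).edgeSet) :
    ∃! l, l < 2 * k ∧ e ∈ stagePairs d l := by
  have hex : ∃ x y, e = s(x, y) ∧ ∃ i, IsStep i x y := by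
    induction e using Sym2.ind with
    | _ x y =>
      rw [SimpleGraph.mem_edgeSet, gridGraph_adj] at he
      obtain ⟨i, h | h⟩ := he
      · exact ⟨x, y, rfl, i, h⟩
      · exact ⟨y, x, Sym2.eq_swap, i, h⟩
  obtain ⟨x, y, rfl, i, h⟩ := hex
  have hl := h.level_eq
  rcases Nat.even_or_odd (level y) with hy | hy
  · have hx : Odd (level x) := by
      rw [Nat.even_iff] at hy
      rw [Nat.odd_iff]
      omega
    refine ⟨k + i, ⟨by omega, mem_stagePairs.2 ⟨i, Or.inr ⟨hx, Or.inr ⟨rfl, h⟩⟩⟩⟩, ?_⟩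
    rintro l ⟨-, hm⟩
    obtain ⟨j, ⟨hp, -⟩ | ⟨-, ⟨-, h'⟩ | ⟨hl', h'⟩⟩⟩ := mem_stagePairs.1 hm
    · rw [Nat.odd_iff] at hp
      rw [Nat.even_iff] at hy
      omega
    · have := h'.level_eq
      omega
    · rw [h.index_unique h', hl']
  · refine ⟨k - 1 - i, ⟨by omega, mem_stagePairs.2 ⟨i, Or.inl ⟨hy, Or.inl ⟨by omega, h⟩⟩⟩⟩, ?_⟩
    rintro l ⟨-, hm⟩
    obtain ⟨j, ⟨-, ⟨hl', h'⟩ | ⟨-, h'⟩⟩ | ⟨hp, -⟩⟩ := mem_stagePairs.1 hm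
    · rw [h.index_unique h']
      omega
    · have := h'.level_eq
      omega
    · rw [Nat.odd_iff] at hp hy
      omega

theorem rankEquiv_stripKey_shift (hc : IsStripIndexing d P c) (t : ℕ) :
    IsSwapLayer (rankEquiv _ (stripKey_injective hc t))
      (rankEquiv _ (stripKey_injective hc (t + 1))) ∧
    (∀ v, level v % 2 = 1 → rankEquiv _ (stripKey_injective hc t) v ≤
      rankEquiv _ (stripKey_injective hc (t + 1)) v) ∧
    (∀ v, level v % 2 = 0 → rankEquiv _ (stripKey_injective hc (t + 1)) v ≤
      rankEquiv _ (stripKey_injective hc t) v) := by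
  refine rankEquiv_shift (p := fun v => level v % 2) _ _ (fun v => Nat.mod_lt _ two_pos)
    (fun v => stripKey_emod_two t v) (fun v => ?_)
  rw [stripKey, stripKey]
  push_cast
  ring

/-- The swap network in which all odd vertices move upward at unit speed through the infinite
strip, restricted to the grid. The stage `l` is performed after `time l` swap layers. -/
noncomputable def stripNetwork (hc : IsStripIndexing d P c) (D : ℕ) (time : ℕ → ℕ)
    (hle : ∀ l, l < 2 * k → time l ≤ D)
    (hmono : ∀ l l', l ≤ l' → l' < 2 * k → time l ≤ time l')
    (hdown : ∀ i : Fin k, c i = time (k - 1 - i) ∨ c i = time (k - 1 - i) + 1)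
    (hup : ∀ i : Fin k, P = c i + time (k + i) ∨ P = c i + time (k + i) + 1) :
    SwapNetwork (gridGraph d) where
  swapDepth := D
  order t := rankEquiv _ (stripKey_injective hc t)
  swap_layer t _ := (rankEquiv_stripKey_shift hc t).1
  interactionDepth := 2 * k
  time := time
  time_le := hle
  time_mono := hmono
  pairs := stagePairs d
  pairs_subset l _ := stagePairs_subset l
  pairs_disjoint l _ _ _ _ := stagePairs_disjoint
  complete _ := exists_mem_stagePairs
  pairs_adjacent := by
    have key : ∀ (l : ℕ) (u v : GridVertex d) (i : Fin k), Odd (level v) →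
        ((l + 1 + (i : ℕ) = k ∧ IsStep i u v) ∨ (l = k + (i : ℕ) ∧ IsStep i v u)) →
        AdjacentIn (rankEquiv _ (stripKey_injective hc (time l))) u v := by
      rintro l u v i hv (⟨hl, h⟩ | ⟨hl, h⟩)
      · refine adjacentIn_rankEquiv_stripKey hc (h.even_left hv) hv ?_
        rw [stripIndex_of_step_to_odd h hv]
        have := hdown i
        rw [show k - 1 - (i : ℕ) = l by omega] at this
        omega
      · refine adjacentIn_rankEquiv_stripKey hc (h.even_right hv) hv ?_
        rw [stripIndex_of_step_from_odd h hv]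
        have := hup i
        rw [← hl] at this
        omega
    intro l _ u v h
    obtain ⟨i, ⟨hv, h⟩ | ⟨hu, h⟩⟩ := mem_stagePairs.1 h
    · exact key l u v i hv h
    · exact (key l v u i hu h).symm

theorem isInterlacing_rankEquiv_stripKey (hc : IsStripIndexing d P c)
    (hc1 : ∀ i : Fin k, k ≤ (i : ℕ) + 2 → c i ≤ 1) :
    IsInterlacing (rankEquiv _ (stripKey_injective hc 0)) where
  odd_order u v hu hv := by
    rw [rankEquiv_lt_iff, stripKey_of_odd hu, stripKey_of_odd hv,
      ← hc u v (by rw [Nat.odd_iff.1 hu, Nat.odd_iff.1 hv])]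
    omega
  even_order u v hu hv := by
    rw [rankEquiv_lt_iff, stripKey_of_even hu, stripKey_of_even hv,
      ← hc u v (by rw [Nat.even_iff.1 hu, Nat.even_iff.1 hv])]
    omega
  adjacent u v i hv hi h := by
    refine adjacentIn_rankEquiv_stripKey hc (h.even_left hv) hv ?_
    rw [stripIndex_of_step_to_odd h hv]
    have := hc1 i hi
    omega

/-- An interlacing `r` is rightmost if the even vertices behind an odd vertex in `r` are
behind it in every interlacing. -/
theorem isRightmostInterlacing_of_forced
    {r : GridVertex d ≃ Fin (Fintype.card (GridVertex d))} (hr : IsInterlacing r)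
    (h : ∀ r' : GridVertex d ≃ Fin (Fintype.card (GridVertex d)), IsInterlacing r' →
      ∀ v w, Odd (level v) → Even (level w) → r v < r w → r' v < r' w) :
    IsRightmostInterlacing r := by
  classical
  refine ⟨hr, fun r' hr' v hv => ?_⟩
  -- A position counts the predecessors. The odd predecessors of `v` are the same in all
  -- interlacings, so only the even ones have to be compared.
  have hcard : ∀ (q : GridVertex d ≃ Fin (Fintype.card (GridVertex d))),
      (q v : ℕ) = (Finset.univ.filter fun x => q x < q v).card := by
    intro q
    have : (Finset.univ.filter fun x => q x < q v) = (Finset.Iio (q v)).map q.symm.toEmbedding := by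
      ext x
      simp
    rw [this, Finset.card_map, Fin.card_Iio]
  rw [Fin.le_def, hcard r', hcard r]
  refine Finset.card_le_card fun x hx => ?_
  simp only [Finset.mem_filter, Finset.mem_univ, true_and] at hx ⊢
  rcases Nat.even_or_odd (level x) with hx' | hx'
  · by_contra hge
    rcases (not_lt.1 hge).lt_or_eq with hlt | heq
    · exact absurd (h r' hr' v x hv hx' hlt) (not_lt.2 hx.le)
    · rw [r.injective heq] at hx
      exact lt_irrefl _ hx
  · rw [hr.odd_order x v hx' hv, ← hr'.odd_order x v hx' hv]
    exact hx

theorem AdjacentIn.lt_of_lt {V : Type} {n : ℕ} {r : V ≃ Fin n} {u v w : V}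
    (h : AdjacentIn r u v) (hw : w ≠ v) (huw : r u < r w) : r v < r w := by
  have hne : (r w : ℕ) ≠ r v := fun e => hw (r.injective (Fin.ext e))
  rw [Fin.lt_def] at *
  rcases h with h | h <;> omega

theorem IsInterlacing.lt_of_step {r : GridVertex d ≃ Fin (Fintype.card (GridVertex d))}
    (hr : IsInterlacing r) {i : Fin k} (hi : k ≤ (i : ℕ) + 2) {u v w : GridVertex d}
    (h : IsStep i u v) (hv : Odd (level v)) (hw : Even (level w)) (huw : RStarLT u w) :
    r v < r w := by
  refine (hr.adjacent u v i hv hi h).lt_of_lt ?_ ((hr.even_order u w (h.even_left hv) hw).2 huw)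
  rintro rfl
  exact Nat.not_even_iff_odd.2 hv hw

/-- Two odd vertices that are both adjacent to `u` must lie on opposite sides of it. -/
theorem IsInterlacing.lt_of_common {r : GridVertex d ≃ Fin (Fintype.card (GridVertex d))}
    (hr : IsInterlacing r) {i j : Fin k} (hi : k ≤ (i : ℕ) + 2) (hj : k ≤ (j : ℕ) + 2)
    {u v v' : GridVertex d} (h : IsStep i u v) (h' : IsStep j u v') (hv : Odd (level v))
    (hv' : Odd (level v')) (hlt : RStarLT v v') : r v < r u := by
  have h1 := hr.adjacent u v i hv hi h
  have h2 := hr.adjacent u v' j hv' hj h'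
  have h3 := (hr.odd_order v v' hv hv').2 hlt
  rw [Fin.lt_def] at *
  rcases h1 with h1 | h1 <;> rcases h2 with h2 | h2 <;> omega

theorem stripNetwork_isDiagonalInterleaving (hc : IsStripIndexing d P c) {D : ℕ} {time : ℕ → ℕ}
    (hle : ∀ l, l < 2 * k → time l ≤ D)
    (hmono : ∀ l l', l ≤ l' → l' < 2 * k → time l ≤ time l')
    (hdown : ∀ i : Fin k, c i = time (k - 1 - i) ∨ c i = time (k - 1 - i) + 1)
    (hup : ∀ i : Fin k, P = c i + time (k + i) ∨ P = c i + time (k + i) + 1)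
    (hc1 : ∀ i : Fin k, k ≤ (i : ℕ) + 2 → c i ≤ 1)
    (hforced : ∀ r : GridVertex d ≃ Fin (Fintype.card (GridVertex d)), IsInterlacing r →
      ∀ v w, Odd (level v) → Even (level w) → stripIndex P c v < stripIndex P c w → r v < r w) :
    (stripNetwork hc D time hle hmono hdown hup).IsDiagonalInterleaving where
  initial := by
    refine isRightmostInterlacing_of_forced (isInterlacing_rankEquiv_stripKey hc hc1) ?_
    intro r' hr' v w hv hw h
    refine hforced r' hr' v w hv hw ?_
    replace h := (rankEquiv_lt_iff (stripKey_injective hc 0) v w).1 h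
    rw [stripKey_of_odd hv, stripKey_of_even hw] at h
    omega
  odd_upward t _ v hv := (rankEquiv_stripKey_shift hc t).2.1 v (Nat.odd_iff.1 hv)
  even_downward t _ v hv := (rankEquiv_stripKey_shift hc t).2.2 v (Nat.even_iff.1 hv)
  stages := rfl
  pairs_eq _ _ := rfl

end Interleaving

/-! ### Degrees and interaction depths -/

section Degree

variable {V : Type} [Fintype V] {G : SimpleGraph V}

theorem graphDegree_eq {n : ℕ} (hle : ∀ v, (G.neighborSet v).ncard ≤ n)
    (hge : ∃ v, n ≤ (G.neighborSet v).ncard) : graphDegree G = n := by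
  classical
  have hdeg : ∀ v, G.degree v = (G.neighborSet v).ncard := fun v => by
    rw [← SimpleGraph.card_neighborSet_eq_degree, ← Nat.card_eq_fintype_card]
    rfl
  obtain ⟨v, hv⟩ := hge
  have : graphDegree G = G.maxDegree := by
    unfold graphDegree
    congr!
  rw [this]
  refine le_antisymm (G.maxDegree_le_of_forall_degree_le n fun v => ?_) ?_
  · rw [hdeg]
    exact hle v
  · rw [← hdeg] at hv
    exact hv.trans (G.degree_le_maxDegree v)

/-- Sending a neighbour to the layer of its edge is injective, since the pairs in a layer are
disjoint. -/
theorem SwapNetwork.ncard_neighborSet_le (W : SwapNetwork G) (v : V) :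
    (G.neighborSet v).ncard ≤ W.interactionDepth := by
  have hex : ∀ u : V, ∃ l, G.Adj v u → l < W.interactionDepth ∧ s(v, u) ∈ W.pairs l := by
    intro u
    by_cases h : G.Adj v u
    · obtain ⟨l, hl, -⟩ := W.complete s(v, u) h
      exact ⟨l, fun _ => hl⟩
    · exact ⟨0, fun h' => absurd h' h⟩
  choose l hl using hex
  calc (G.neighborSet v).ncard
      ≤ ((Finset.range W.interactionDepth : Finset ℕ) : Set ℕ).ncard := by
        refine Set.ncard_le_ncard_of_injOn l (fun u hu => ?_) ?_ (Finset.finite_toSet _)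
        · simpa using (hl u hu).1
        · intro u hu w hw e
          have hw' := (hl w hw).2
          rw [← e] at hw'
          exact W.pairs_disjoint _ (hl u hu).1 v u w (hl u hu).2 hw'
    _ = W.interactionDepth := by rw [Set.ncard_coe_finset, Finset.card_range]

theorem le_ncard_of_injective {α : Type} [Finite α] {S : Set α} {n : ℕ} (g : Fin n → α)
    (hg : Function.Injective g) (hS : ∀ i, g i ∈ S) : n ≤ S.ncard := by
  calc n = (Set.univ : Set (Fin n)).ncard := by simp [Set.ncard_univ]
    _ ≤ S.ncard := Set.ncard_le_ncard_of_injOn g (fun i _ => hS i) hg.injOn (Set.toFinite _)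

theorem ncard_union_le_add_one {α : Type} [Finite α] {S T : Set α} {n : ℕ} (hS : S.ncard ≤ n)
    (hT : T.Subsingleton) : (S ∪ T).ncard ≤ n + 1 :=
  (Set.ncard_union_le S T).trans
    (Nat.add_le_add hS ((Set.ncard_le_one_iff_subsingleton).2 hT))

theorem minSwapDepth_eq {D : ℕ} (W : SwapNetwork G) (hW : W.swapDepth = D)
    (h : ∀ W' : SwapNetwork G, D ≤ W'.swapDepth) : minSwapDepth G = D := by
  refine le_antisymm (Nat.sInf_le ⟨W, hW⟩) (le_csInf ⟨_, W, rfl⟩ ?_)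
  rintro _ ⟨W', rfl⟩
  exact h W'

theorem minInteractionDepth_eq {L : ℕ} (W : SwapNetwork G) (hW : W.interactionDepth = L)
    (h : ∀ W' : SwapNetwork G, L ≤ W'.interactionDepth) : minInteractionDepth G = L := by
  refine le_antisymm (Nat.sInf_le ⟨W, hW⟩) (le_csInf ⟨_, W, rfl⟩ ?_)
  rintro _ ⟨W', rfl⟩
  exact h W'

theorem subsingleton_step_right {k : ℕ} {d : Fin k → ℕ} (i : Fin k) (x : GridVertex d) :
    {y | IsStep i x y}.Subsingleton := fun _ h _ h' => h.right_unique h'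

theorem subsingleton_step_left {k : ℕ} {d : Fin k → ℕ} (i : Fin k) (x : GridVertex d) :
    {y | IsStep i y x}.Subsingleton := fun _ h _ h' => h.left_unique h'

end Degree

/-! ### The two-dimensional grid -/

section Grid₂

variable {M N : ℕ}

/-- The vertex with the given coordinates. -/
def point₂ (a : Fin M) (b : Fin N) : GridVertex ![M, N] :=
  Fin.cons a (Fin.cons b finZeroElim)

theorem exists_eq_point₂ (x : GridVertex ![M, N]) : ∃ (a : Fin M) (b : Fin N), x = point₂ a b := by
  refine ⟨x 0, x 1, funext fun i => ?_⟩
  fin_cases i <;> rfl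

theorem point₂_inj {a a' : Fin M} {b b' : Fin N} :
    point₂ a b = point₂ a' b' ↔ a = a' ∧ b = b' :=
  ⟨fun h => ⟨congrFun h 0, congrFun h 1⟩, by rintro ⟨rfl, rfl⟩; rfl⟩

theorem level_point₂ (a : Fin M) (b : Fin N) : level (point₂ a b) = a + b := by
  rw [level, Fin.sum_univ_two]
  rfl

theorem isStep_point₂_zero {a a' : Fin M} (b : Fin N) (h : (a : ℕ) + 1 = a') :
    IsStep 0 (point₂ a b) (point₂ a' b) := by
  refine ⟨h, fun j hj => ?_⟩
  fin_cases j
  · exact absurd rfl hj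
  · rfl

theorem isStep_point₂_one (a : Fin M) {b b' : Fin N} (h : (b : ℕ) + 1 = b') :
    IsStep 1 (point₂ a b) (point₂ a b') := by
  refine ⟨h, fun j hj => ?_⟩
  fin_cases j
  · rfl
  · exact absurd rfl hj

theorem rStarLT_point₂ {a a' : Fin M} {b b' : Fin N} :
    RStarLT (point₂ a b) (point₂ a' b') ↔
      (a : ℕ) + b < a' + b' ∨ ((a : ℕ) + b = a' + b' ∧ (a' : ℕ) < a) := by
  rw [RStarLT, level_point₂, level_point₂, Fin.exists_fin_two]
  refine or_congr_right (and_congr_right fun h => ⟨?_, fun h' => Or.inl ⟨?_, h'⟩⟩)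
  · rintro (⟨-, h'⟩ | ⟨h', h''⟩)
    · exact h'
    · have e : a = a' := h' 0 (by decide)
      have e' : (b' : ℕ) < b := h''
      rw [e] at h
      omega
  · intro j hj
    exact absurd hj (by simp)

theorem stripIndex_point₂ (a : Fin M) (b : Fin N) :
    stripIndex M ![1, 0] (point₂ a b) = (M * ((a + b) / 2) : ℕ) - a := by
  have h₀ : ((point₂ a b 0 : Fin (![M, N] 0)) : ℕ) = a := rfl
  rw [stripIndex, level_point₂, Fin.sum_univ_two, h₀]
  simp

/-- The in-diagonal offset `a` is below `M`, so each diagonal of a given parity fits in its own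
block of `M` indices, and inside the block larger `a` comes first. -/
theorem isStripIndexing₂ (M N : ℕ) : IsStripIndexing ![M, N] M ![1, 0] := by
  intro u v h
  obtain ⟨a, b, rfl⟩ := exists_eq_point₂ u
  obtain ⟨a', b', rfl⟩ := exists_eq_point₂ v
  rw [stripIndex_point₂, stripIndex_point₂, rStarLT_point₂]
  rw [level_point₂, level_point₂] at h
  have ha := a.2
  have ha' := a'.2
  rcases lt_trichotomy (((a : ℕ) + b) / 2) ((a' + b') / 2) with hl | hl | hl
  · have := Nat.mul_le_mul_left M (Nat.succ_le_of_lt hl)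
    rw [Nat.mul_succ] at this
    omega
  · rw [hl]
    omega
  · have := Nat.mul_le_mul_left M (Nat.succ_le_of_lt hl)
    rw [Nat.mul_succ] at this
    omega

/-- If `v - e_1` exists, it has the index of `v`, so it precedes `w` and takes the adjacent `v` with
it. Otherwise `v - e_0` has index one larger and does the same unless it equals `w`; in that case
`w` is squeezed between `v` and `w + e_1`. -/
theorem forced₂ (hMN : M ≤ N)
    (r : GridVertex ![M, N] ≃ Fin (Fintype.card (GridVertex ![M, N]))) (hr : IsInterlacing r)
    (v w : GridVertex ![M, N]) (hv : Odd (level v)) (hw : Even (level w))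
    (h : stripIndex M ![1, 0] v < stripIndex M ![1, 0] w) : r v < r w := by
  have hc := isStripIndexing₂ M N
  obtain ⟨a, b, rfl⟩ := exists_eq_point₂ v
  have ha := a.2
  have hlev := level_point₂ a b
  by_cases hb : (b : ℕ) = 0
  · have ha0 : (a : ℕ) ≠ 0 := by
      rw [hlev, Nat.odd_iff] at hv
      omega
    have hu : IsStep 0 (point₂ (⟨a - 1, by omega⟩ : Fin M) b) (point₂ a b) :=
      isStep_point₂_zero b (by simp; omega)
    have hidx := stripIndex_of_step_to_odd (P := M) (c := ![1, 0]) hu hv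
    have hpar := Nat.even_iff.1 (hu.even_left hv)
    by_cases huw : point₂ (⟨a - 1, by omega⟩ : Fin M) b = w
    · rw [← huw]
      refine hr.lt_of_common (by simp) (by simp) hu
        (isStep_point₂_one (b' := ⟨1, by omega⟩) _ (by simp [hb])) hv ?_ ?_
      · rw [level_point₂, Nat.odd_iff] at *
        simp
        omega
      · rw [rStarLT_point₂]
        simp
        omega
    · refine hr.lt_of_step (by simp) hu hv hw ((rStarLT_or_of_ne huw).resolve_right fun hwu => ?_)
      have := (hc w _ (by rw [Nat.even_iff.1 hw, hpar])).2 hwu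
      simp only [Matrix.cons_val_zero, Nat.cast_one] at hidx
      omega
  · have hu : IsStep 1 (point₂ a (⟨b - 1, by omega⟩ : Fin N)) (point₂ a b) :=
      isStep_point₂_one a (by simp; omega)
    have hidx := stripIndex_of_step_to_odd (P := M) (c := ![1, 0]) hu hv
    refine hr.lt_of_step (by simp) hu hv hw
      ((hc _ w (by rw [Nat.even_iff.1 hw, Nat.even_iff.1 (hu.even_left hv)])).1 ?_)
    rw [hidx]
    simpa using h

theorem isLayeredGrid₂ (M N : ℕ) :
    IsLayeredGrid (gridGraph ![M, N]) (fun _ : Fin 1 => point₂ (M := M) (N := N)) where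
  inj _ _ _ _ _ _ h := ⟨Subsingleton.elim _ _, point₂_inj.1 h⟩
  layer _ _ _ _ h := absurd (Subsingleton.elim _ _) h
  fst _ _ _ j h := gridGraph_adj.2 ⟨0, Or.inl (isStep_point₂_zero j h)⟩
  snd _ i _ _ h := gridGraph_adj.2 ⟨1, Or.inl (isStep_point₂_one i h)⟩

theorem le_swapDepth₂ (hM : 1 ≤ M) (hMN : M ≤ N) (W : SwapNetwork (gridGraph ![M, N])) :
    M - 1 ≤ W.swapDepth := by
  rcases hM.lt_or_eq with hM | rfl
  · have := W.le_swapDepth_of_isLayeredGrid (isLayeredGrid₂ M N) one_pos hM hMN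
    omega
  · simp

theorem ncard_neighborSet_le₂ (v : GridVertex ![M, N]) :
    ((gridGraph ![M, N]).neighborSet v).ncard ≤ 4 := by
  have hsub : (gridGraph ![M, N]).neighborSet v ⊆
      ((({u | IsStep 0 v u} ∪ {u | IsStep 0 u v}) ∪ {u | IsStep 1 v u}) ∪ {u | IsStep 1 u v}) := by
    intro u hu
    rw [SimpleGraph.mem_neighborSet, gridGraph_adj, Fin.exists_fin_two] at hu
    simp only [Set.mem_union, Set.mem_ofPred_eq]
    tauto
  refine (Set.ncard_le_ncard hsub (Set.toFinite _)).trans ?_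
  exact ncard_union_le_add_one (ncard_union_le_add_one (ncard_union_le_add_one
    ((Set.ncard_le_one_iff_subsingleton).2 (subsingleton_step_right 0 v))
    (subsingleton_step_left 0 v)) (subsingleton_step_right 1 v)) (subsingleton_step_left 1 v)

theorem exists_le_ncard_neighborSet₂ (hM : 3 ≤ M) (hN : 3 ≤ N) :
    ∃ v, 4 ≤ ((gridGraph ![M, N]).neighborSet v).ncard := by
  let a : Fin 3 → Fin M := Fin.castLE hM
  let b : Fin 3 → Fin N := Fin.castLE hN
  refine ⟨point₂ (a 1) (b 1), le_ncard_of_injective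
    ![point₂ (a 0) (b 1), point₂ (a 2) (b 1), point₂ (a 1) (b 0), point₂ (a 1) (b 2)] ?_ ?_⟩
  · intro x y
    fin_cases x <;> fin_cases y <;> simp [point₂_inj, a, b]
  · intro x
    rw [SimpleGraph.mem_neighborSet, gridGraph_adj]
    fin_cases x
    · exact ⟨0, Or.inr (isStep_point₂_zero _ rfl)⟩
    · exact ⟨0, Or.inl (isStep_point₂_zero _ rfl)⟩
    · exact ⟨1, Or.inr (isStep_point₂_one _ rfl)⟩
    · exact ⟨1, Or.inl (isStep_point₂_one _ rfl)⟩

theorem exists_network₂ (hM : 1 ≤ M) (hMN : M ≤ N) :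
    ∃ W : SwapNetwork (gridGraph ![M, N]), W.IsDiagonalInterleaving ∧ W.swapDepth = M - 1 ∧
      W.interactionDepth = 4 := by
  refine ⟨_, stripNetwork_isDiagonalInterleaving (isStripIndexing₂ M N) (D := M - 1)
    -- The times are `0, 0, M - 2, M - 1`: the upward index differences are `M - 1` and `M`, each
    -- met one layer early. For `M = 1` truncated subtraction turns `M - 2` into `0`, which is still
    -- admissible.
    (time := fun l => if l < 2 then 0 else M + l - 4) ?_ ?_ ?_ ?_ ?_ (forced₂ hMN), rfl, rfl⟩
  · intro l hl
    split_ifs <;> omega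
  · intro l l' hl hl'
    split_ifs <;> omega
  · intro i
    fin_cases i <;> simp
  · intro i
    fin_cases i <;> simp <;> omega
  · intro i
    fin_cases i <;> simp

end Grid₂

/-! ### The grid with two layers -/

section Grid₃

variable {M N : ℕ}

/-- The vertex with the given coordinates. -/
def point₃ (s : Fin 2) (a : Fin M) (b : Fin N) : GridVertex ![2, M, N] :=
  Fin.cons s (Fin.cons a (Fin.cons b finZeroElim))

theorem exists_eq_point₃ (x : GridVertex ![2, M, N]) :
    ∃ (s : Fin 2) (a : Fin M) (b : Fin N), x = point₃ s a b := by
  refine ⟨x 0, x 1, x 2, funext fun i => ?_⟩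
  fin_cases i <;> rfl

theorem point₃_inj {s s' : Fin 2} {a a' : Fin M} {b b' : Fin N} :
    point₃ s a b = point₃ s' a' b' ↔ s = s' ∧ a = a' ∧ b = b' :=
  ⟨fun h => ⟨congrFun h 0, congrFun h 1, congrFun h 2⟩, by rintro ⟨rfl, rfl, rfl⟩; rfl⟩

theorem level_point₃ (s : Fin 2) (a : Fin M) (b : Fin N) :
    level (point₃ s a b) = s + a + b := by
  rw [level, Fin.sum_univ_three]
  rfl

theorem isStep_point₃_zero {s s' : Fin 2} (a : Fin M) (b : Fin N) (h : (s : ℕ) + 1 = s') :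
    IsStep 0 (point₃ s a b) (point₃ s' a b) := by
  refine ⟨h, fun j hj => ?_⟩
  fin_cases j
  · exact absurd rfl hj
  · rfl
  · rfl

theorem isStep_point₃_one (s : Fin 2) {a a' : Fin M} (b : Fin N) (h : (a : ℕ) + 1 = a') :
    IsStep 1 (point₃ s a b) (point₃ s a' b) := by
  refine ⟨h, fun j hj => ?_⟩
  fin_cases j
  · rfl
  · exact absurd rfl hj
  · rfl

theorem isStep_point₃_two (s : Fin 2) (a : Fin M) {b b' : Fin N} (h : (b : ℕ) + 1 = b') :
    IsStep 2 (point₃ s a b) (point₃ s a b') := by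
  refine ⟨h, fun j hj => ?_⟩
  fin_cases j
  · rfl
  · rfl
  · exact absurd rfl hj

theorem rStarLT_point₃ {s s' : Fin 2} {a a' : Fin M} {b b' : Fin N} :
    RStarLT (point₃ s a b) (point₃ s' a' b') ↔
      (s : ℕ) + a + b < s' + a' + b' ∨ ((s : ℕ) + a + b = s' + a' + b' ∧
        ((s' : ℕ) < s ∨ (s : ℕ) = s' ∧ (a' : ℕ) < a)) := by
  rw [RStarLT, level_point₃, level_point₃]
  refine or_congr_right (and_congr_right fun h => ⟨?_, ?_⟩)
  · rintro ⟨i, hi, hlt⟩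
    fin_cases i
    · exact Or.inl hlt
    · have e : s = s' := hi 0 (by decide)
      exact Or.inr ⟨congrArg Fin.val e, hlt⟩
    · have e : s = s' := hi 0 (by decide)
      have e' : a = a' := hi 1 (by decide)
      have hlt' : (b' : ℕ) < b := hlt
      rw [e, e'] at h
      omega
  · rintro (hlt | ⟨e, hlt⟩)
    · exact ⟨0, fun j hj => absurd hj (by simp), hlt⟩
    · refine ⟨1, fun j hj => ?_, hlt⟩
      fin_cases j
      · exact Fin.ext e
      · exact absurd hj (by decide)
      · exact absurd hj (by decide)

theorem stripIndex_point₃ (s : Fin 2) (a : Fin M) (b : Fin N) :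
    stripIndex (2 * M) ![M, 1, 0] (point₃ s a b) =
      2 * (M * ((s + a + b) / 2 : ℕ) : ℕ) - ((M * s : ℕ) : ℤ) - a := by
  have h₀ : ((point₃ s a b 0 : Fin (![2, M, N] 0)) : ℕ) = s := rfl
  have h₁ : ((point₃ s a b 1 : Fin (![2, M, N] 1)) : ℕ) = a := rfl
  rw [stripIndex, level_point₃, Fin.sum_univ_three, h₀, h₁]
  simp only [Matrix.cons_val_zero, Matrix.cons_val_one, Matrix.cons_val, Nat.cast_one, Nat.cast_zero, zero_mul, add_zero, one_mul]
  push_cast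
  ring

theorem isStripIndexing₃ (M N : ℕ) : IsStripIndexing ![2, M, N] (2 * M) ![M, 1, 0] := by
  intro u v h
  obtain ⟨s, a, b, rfl⟩ := exists_eq_point₃ u
  obtain ⟨s', a', b', rfl⟩ := exists_eq_point₃ v
  rw [stripIndex_point₃, stripIndex_point₃, rStarLT_point₃]
  rw [level_point₃, level_point₃] at h
  have ha := a.2
  have ha' := a'.2
  -- Splitting on the spin removes the product `M * s`, so the rest is linear arithmetic.
  have hs : M * (s : ℕ) = 0 ∧ (s : ℕ) = 0 ∨ M * (s : ℕ) = M ∧ (s : ℕ) = 1 := by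
    fin_cases s <;> simp
  have hs' : M * (s' : ℕ) = 0 ∧ (s' : ℕ) = 0 ∨ M * (s' : ℕ) = M ∧ (s' : ℕ) = 1 := by
    fin_cases s' <;> simp
  rcases lt_trichotomy (((s : ℕ) + a + b) / 2) ((s' + a' + b') / 2) with hl | hl | hl
  · have := Nat.mul_le_mul_left M (Nat.succ_le_of_lt hl)
    rw [Nat.mul_succ] at this
    omega
  · rw [hl]
    omega
  · have := Nat.mul_le_mul_left M (Nat.succ_le_of_lt hl)
    rw [Nat.mul_succ] at this
    omega

/-- The argument of `forced₂` applies inside a layer, with one exception: `(1, 0, 0)` has no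
predecessor in the last two directions. It comes before `(0, 1, 0)` in `r*`, which in turn precedes
the origin, the first even vertex. -/
theorem forced₃ (hM : 2 ≤ M) (hN : 2 ≤ N)
    (r : GridVertex ![2, M, N] ≃ Fin (Fintype.card (GridVertex ![2, M, N])))
    (hr : IsInterlacing r) (v w : GridVertex ![2, M, N]) (hv : Odd (level v))
    (hw : Even (level w))
    (h : stripIndex (2 * M) ![M, 1, 0] v < stripIndex (2 * M) ![M, 1, 0] w) : r v < r w := by
  have hc := isStripIndexing₃ M N
  obtain ⟨s, a, b, rfl⟩ := exists_eq_point₃ v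
  have ha := a.2
  have hlev := level_point₃ s a b
  by_cases hb : (b : ℕ) = 0
  · by_cases ha0 : (a : ℕ) = 0
    · have hs : (s : ℕ) = 1 := by
        rw [hlev, Nat.odd_iff] at hv
        omega
      set o : GridVertex ![2, M, N] := point₃ 0 ⟨0, by omega⟩ ⟨0, by omega⟩ with ho
      set p : GridVertex ![2, M, N] := point₃ 0 ⟨1, by omega⟩ ⟨0, by omega⟩ with hp
      have hpodd : Odd (level p) := by
        rw [hp, level_point₃]
        simp
      have hvp : r (point₃ s a b) < r p := by
        rw [hr.odd_order _ _ hv hpodd, hp, rStarLT_point₃]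
        simp [ha0, hb, hs]
      have hpo : r p < r o := by
        refine hr.lt_of_common (i := 1) (j := 2)
          (v' := point₃ 0 ⟨0, by omega⟩ ⟨1, by omega⟩) (by simp) (by simp)
          (isStep_point₃_one _ _ rfl) (isStep_point₃_two _ _ rfl) hpodd ?_ ?_
        · rw [level_point₃]
          simp
        · rw [rStarLT_point₃]
          simp
      have how : r o ≤ r w := by
        by_contra hlt
        rw [not_le, hr.even_order _ _ hw (by rw [ho, level_point₃]; simp)] at hlt
        obtain ⟨s', a', b', rfl⟩ := exists_eq_point₃ w
        rw [ho, rStarLT_point₃] at hlt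
        simp at hlt
        omega
      exact (hvp.trans hpo).trans_le how
    · have hu : IsStep 1 (point₃ s (⟨a - 1, by omega⟩ : Fin M) b) (point₃ s a b) :=
        isStep_point₃_one s b (by simp; omega)
      have hidx := stripIndex_of_step_to_odd (P := 2 * M) (c := ![M, 1, 0]) hu hv
      have hpar := Nat.even_iff.1 (hu.even_left hv)
      by_cases huw : point₃ s (⟨a - 1, by omega⟩ : Fin M) b = w
      · rw [← huw]
        refine hr.lt_of_common (by simp) (by simp) hu
          (isStep_point₃_two (b' := ⟨1, by omega⟩) _ _ (by simp [hb])) hv ?_ ?_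
        · rw [level_point₃, Nat.odd_iff] at *
          simp
          omega
        · rw [rStarLT_point₃]
          simp
          omega
      · refine hr.lt_of_step (by simp) hu hv hw
          ((rStarLT_or_of_ne huw).resolve_right fun hwu => ?_)
        have := (hc w _ (by rw [Nat.even_iff.1 hw, hpar])).2 hwu
        simp only [Matrix.cons_val_one, Matrix.cons_val_zero, Nat.cast_one] at hidx
        omega
  · have hu : IsStep 2 (point₃ s a (⟨b - 1, by omega⟩ : Fin N)) (point₃ s a b) :=
      isStep_point₃_two s a (by simp; omega)
    have hidx := stripIndex_of_step_to_odd (P := 2 * M) (c := ![M, 1, 0]) hu hv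
    refine hr.lt_of_step (by simp) hu hv hw
      ((hc _ w (by rw [Nat.even_iff.1 hw, Nat.even_iff.1 (hu.even_left hv)])).1 ?_)
    rw [hidx]
    simpa using h

/-- The two spin layers form the complete graph factor, so `s = 2` doubles the boundary. -/
theorem isLayeredGrid₃ (M N : ℕ) :
    IsLayeredGrid (gridGraph ![2, M, N]) (point₃ (M := M) (N := N)) where
  inj _ _ _ _ _ _ h := point₃_inj.1 h
  layer σ σ' i j h := by
    refine gridGraph_adj.2 ⟨0, ?_⟩
    rcases lt_or_gt_of_ne h with h | h
    · exact Or.inl (isStep_point₃_zero i j (by omega))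
    · exact Or.inr (isStep_point₃_zero i j (by omega))
  fst s _ _ j h := gridGraph_adj.2 ⟨1, Or.inl (isStep_point₃_one s j h)⟩
  snd s i _ _ h := gridGraph_adj.2 ⟨2, Or.inl (isStep_point₃_two s i h)⟩

theorem le_swapDepth₃ (hM : 2 ≤ M) (hMN : M ≤ N) (W : SwapNetwork (gridGraph ![2, M, N])) :
    2 * M - 1 ≤ W.swapDepth := by
  have := W.le_swapDepth_of_isLayeredGrid (isLayeredGrid₃ M N) two_pos hM hMN
  omega

/-- A path on two vertices gives only one neighbour in the spin direction, which is why the degree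
bound is 5 and not 6. -/
theorem subsingleton_step_zero (v : GridVertex ![2, M, N]) :
    {u | IsStep 0 v u ∨ IsStep 0 u v}.Subsingleton := by
  have key : ∀ u u' : GridVertex ![2, M, N], IsStep 0 v u → IsStep 0 u' v → False := by
    intro u u' h h'
    have h1 := h.1
    have h2 := h'.1
    have h3 : (u 0 : ℕ) < 2 := (u 0).2
    omega
  rintro u (h | h) u' (h' | h')
  · exact h.right_unique h'
  · exact (key _ _ h h').elim
  · exact (key _ _ h' h).elim
  · exact h.left_unique h'

theorem ncard_neighborSet_le₃ (v : GridVertex ![2, M, N]) :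
    ((gridGraph ![2, M, N]).neighborSet v).ncard ≤ 5 := by
  have hsub : (gridGraph ![2, M, N]).neighborSet v ⊆
      ((({u | IsStep 0 v u ∨ IsStep 0 u v} ∪ {u | IsStep 1 v u}) ∪ {u | IsStep 1 u v}) ∪
        {u | IsStep 2 v u}) ∪ {u | IsStep 2 u v} := by
    intro u hu
    rw [SimpleGraph.mem_neighborSet, gridGraph_adj] at hu
    obtain ⟨i, hi⟩ := hu
    simp only [Set.mem_union, Set.mem_ofPred_eq]
    fin_cases i <;> simp only [Fin.zero_eta, Fin.mk_one, Fin.reduceFinMk] at hi <;> tauto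
  refine (Set.ncard_le_ncard hsub (Set.toFinite _)).trans ?_
  exact ncard_union_le_add_one (ncard_union_le_add_one (ncard_union_le_add_one
    (ncard_union_le_add_one ((Set.ncard_le_one_iff_subsingleton).2 (subsingleton_step_zero v))
      (subsingleton_step_right 1 v)) (subsingleton_step_left 1 v))
    (subsingleton_step_right 2 v)) (subsingleton_step_left 2 v)

theorem exists_le_ncard_neighborSet₃ (hM : 3 ≤ M) (hN : 3 ≤ N) :
    ∃ v, 5 ≤ ((gridGraph ![2, M, N]).neighborSet v).ncard := by
  let a : Fin 3 → Fin M := Fin.castLE hM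
  let b : Fin 3 → Fin N := Fin.castLE hN
  refine ⟨point₃ 0 (a 1) (b 1), le_ncard_of_injective
    ![point₃ 1 (a 1) (b 1), point₃ 0 (a 0) (b 1), point₃ 0 (a 2) (b 1), point₃ 0 (a 1) (b 0),
      point₃ 0 (a 1) (b 2)] ?_ ?_⟩
  · intro x y
    fin_cases x <;> fin_cases y <;> simp [point₃_inj, a, b]
  · intro x
    rw [SimpleGraph.mem_neighborSet, gridGraph_adj]
    fin_cases x
    · exact ⟨0, Or.inl (isStep_point₃_zero _ _ rfl)⟩
    · exact ⟨1, Or.inr (isStep_point₃_one _ _ rfl)⟩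
    · exact ⟨1, Or.inl (isStep_point₃_one _ _ rfl)⟩
    · exact ⟨2, Or.inr (isStep_point₃_two _ _ rfl)⟩
    · exact ⟨2, Or.inl (isStep_point₃_two _ _ rfl)⟩

theorem exists_network₃ (hM : 2 ≤ M) (hN : 2 ≤ N) :
    ∃ W : SwapNetwork (gridGraph ![2, M, N]), W.IsDiagonalInterleaving ∧
      W.swapDepth = 2 * M - 1 ∧ W.interactionDepth = 6 := by
  refine ⟨_, stripNetwork_isDiagonalInterleaving (isStripIndexing₃ M N) (D := 2 * M - 1)
    -- The times are `0, 0, M - 1, M - 1, 2 * M - 2, 2 * M - 1`. Both spin stages have index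
    -- difference `M` and can share a time.
    (time := fun l => if l < 2 then 0 else if l < 4 then M - 1 else 2 * M + l - 6)
    ?_ ?_ ?_ ?_ ?_ (forced₃ hM hN), rfl, rfl⟩
  · intro l hl
    split_ifs <;> omega
  · intro l l' hl hl'
    split_ifs <;> omega
  · intro i
    fin_cases i <;> simp; omega
  · intro i
    fin_cases i <;> simp <;> omega
  · intro i
    fin_cases i <;> simp

theorem stagePairs_nonempty₃ (hM : 2 ≤ M) (hN : 2 ≤ N) {l : ℕ} (hl : l < 6) :
    (stagePairs ![2, M, N] l).Nonempty := by
  let a : Fin 2 → Fin M := Fin.castLE hM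
  let b : Fin 2 → Fin N := Fin.castLE hN
  have h₀ : Odd (level (point₃ 1 (a 0) (b 0))) := by rw [level_point₃]; simp [a, b]
  have h₁ : Odd (level (point₃ 0 (a 1) (b 0))) := by rw [level_point₃]; simp [a, b]
  have h₂ : Odd (level (point₃ 0 (a 0) (b 1))) := by rw [level_point₃]; simp [a, b]
  interval_cases l
  · exact ⟨_, point₃ 0 (a 0) (b 0), _, 2, h₂, rfl, Or.inl ⟨rfl, isStep_point₃_two _ _ rfl⟩⟩
  · exact ⟨_, point₃ 0 (a 0) (b 0), _, 1, h₁, rfl, Or.inl ⟨rfl, isStep_point₃_one _ _ rfl⟩⟩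
  · exact ⟨_, point₃ 0 (a 0) (b 0), _, 0, h₀, rfl, Or.inl ⟨rfl, isStep_point₃_zero _ _ rfl⟩⟩
  · exact ⟨_, point₃ 1 (a 1) (b 0), _, 0, h₁, rfl, Or.inr ⟨rfl, isStep_point₃_zero _ _ rfl⟩⟩
  · exact ⟨_, point₃ 0 (a 1) (b 1), _, 1, h₂, rfl, Or.inr ⟨rfl, isStep_point₃_one _ _ rfl⟩⟩
  · exact ⟨_, point₃ 0 (a 1) (b 1), _, 2, h₁, rfl, Or.inr ⟨rfl, isStep_point₃_two _ _ rfl⟩⟩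

end Grid₃

/-! ### The theorem for both Hubbard models. -/

theorem mainTheorem1 (M N : ℕ) (hM : 1 ≤ M) (hMN : M ≤ N) :
    -- the spinless model
    (∃ W : SwapNetwork (interactionGraph (spinlessHubbard M N)),
      W.IsDiagonalInterleaving ∧
      W.swapDepth = M - 1 ∧
      minSwapDepth (interactionGraph (spinlessHubbard M N)) = M - 1 ∧
      W.interactionDepth = 4 ∧
      (3 ≤ M →
        graphDegree (interactionGraph (spinlessHubbard M N)) = 4 ∧
        minInteractionDepth (interactionGraph (spinlessHubbard M N)) = 4)) ∧
    -- the model with spin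
    (2 ≤ M →
      ∃ W : SwapNetwork (interactionGraph (spinHubbard M N)),
        W.IsDiagonalInterleaving ∧
        W.swapDepth = 2 * M - 1 ∧
        minSwapDepth (interactionGraph (spinHubbard M N)) = 2 * M - 1 ∧
        W.interactionDepth = 6 ∧
        (∀ l, l < 6 → (W.pairs l).Nonempty) ∧
        (3 ≤ M →
          graphDegree (interactionGraph (spinHubbard M N)) = 5 ∧
          ∀ W' : SwapNetwork (interactionGraph (spinHubbard M N)),
            5 ≤ W'.interactionDepth)) := by
  rw [interactionGraph_spinlessHubbard, interactionGraph_spinHubbard]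
  refine ⟨?_, fun hM₂ => ?_⟩
  · obtain ⟨W, hW, hs, hi⟩ := exists_network₂ hM hMN
    refine ⟨W, hW, hs, minSwapDepth_eq W hs (le_swapDepth₂ hM hMN), hi, fun hM₃ => ?_⟩
    have hv := exists_le_ncard_neighborSet₂ hM₃ (hM₃.trans hMN)
    refine ⟨graphDegree_eq ncard_neighborSet_le₂ hv, minInteractionDepth_eq W hi fun W' => ?_⟩
    obtain ⟨v, hv⟩ := hv
    exact hv.trans (W'.ncard_neighborSet_le v)
  · have hN₂ := hM₂.trans hMN
    obtain ⟨W, hW, hs, hi⟩ := exists_network₃ hM₂ hN₂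
    refine ⟨W, hW, hs, minSwapDepth_eq W hs (le_swapDepth₃ hM₂ hMN), hi, fun l hl => ?_,
      fun hM₃ => ?_⟩
    · rw [hW.pairs_eq l hl]
      exact stagePairs_nonempty₃ hM₂ hN₂ hl
    · have hv := exists_le_ncard_neighborSet₃ hM₃ (hM₃.trans hMN)
      refine ⟨graphDegree_eq ncard_neighborSet_le₃ hv, fun W' => ?_⟩
      obtain ⟨v, hv⟩ := hv
      exact hv.trans (W'.ncard_neighborSet_le v)
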